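/- Let $z$ be an indeterminate and $R=\mathbb{Z}[z]$. For $k\ge 0$ let $A_k$ be the set of set partitions of $\{1,\dots,k,1',\dots,k'\}$, drawn as diagrams with top row $1,\dots,k$ and bottom row $1',\dots,k'$. The partition algebra $\mathcal{A}_k(z)$ is the free $R$-module on $A_k$ with product $\rho_1\rho_2=z^{\ell}\,\rho_1\circ\rho_2$, where $\rho_1\circ\rho_2$ is obtained by placing $\rho_1$ above $\rho_2$, identifying the bottom row of $\rho_1$ with the top row of $\rho_2$, and deleting the $\ell$ components that lie entirely in the middle row; $1$ is the diagram with blocks $\{j,j'\}$. Consider the following elements of $A_k$, in each of which every vertex $l$ not mentioned forms a block $\{l,l'\}$: - $s_i$ ($1\le i<k$), with blocks $\{i,(i+1)'\}$ and $\{i+1,i'\}$; - $p_j$ ($1\le j\le k$), with blocks $\{j\}$ and $\{j'\}$; - $p_{i+\frac12}$ ($1\le i<k$), with block $\{i,i+1,i',(i+1)'\}$. Define $L_0=0$, $L_1=p_1$, $\sigma_1=1$, $\sigma_2=s_1$, and $$L_{i+1}=-s_iL_ip_{i+\frac12}-p_{i+\frac12}L_is_i+p_{i+\frac12}L_ip_{i+1}p_{i+\frac12}+s_iL_is_i+\sigma_{i+1}\qquad(i\ge1),$$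 $$\begin{aligned}\sigma_{i+1}={}&s_{i-1}s_i\sigma_is_is_{i-1}+s_ip_{i-\frac12}L_{i-1}s_ip_{i-\frac12}s_i+p_{i-\frac12}L_{i-1}s_ip_{i-\frac12}\\&-s_ip_{i-\frac12}L_{i-1}s_{i-1}p_{i+\frac12}p_ip_{i-\frac12}-p_{i-\frac12}p_ip_{i+\frac12}s_{i-1}L_{i-1}p_{i-\frac12}s_i\qquad(i\ge2),\end{aligned}$$ and define $\sigma_{\frac12}=\sigma_{1+\frac12}=1$ and $$\begin{aligned}\sigma_{i+\frac12}={}&s_{i-1}s_i\sigma_{i-\frac12}s_is_{i-1}+p_{i-\frac12}L_{i-1}s_ip_{i-\frac12}s_i+s_ip_{i-\frac12}L_{i-1}s_ip_{i-\frac12}\\&-p_{i-\frac12}L_{i-1}s_{i-1}p_{i+\frac12}p_ip_{i-\frac12}-s_ip_{i-\frac12}p_ip_{i+\frac12}s_{i-1}L_{i-1}p_{i-\frac12}s_i\qquad(i\ge2).\end{aligned}$$ These elements $\sigma_{i+\frac12}$ and $\sigma_{i+1}$ are defined in $\mathcal{A}_k(z)$ whenever $k\ge i+1$. Then for all integers $i\ge0$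 and $k\ge i+1$, in $\mathcal{A}_k(z)$, $$(\sigma_{i+\frac12})^2=1\qquad\text{and}\qquad(\sigma_{i+1})^2=1.$$ -/

import Mathlib

/-- A partition diagram on `k` strands: a set partition of `{1, …, k, 1', …, k'}`, given as the
equivalence relation "lie in the same block".  `Sum.inl a` is the vertex `a + 1` of the top row and
`Sum.inr a` is the vertex `(a + 1)'` of the bottom row. -/
abbrev PartitionDiagram (k : ℕ) : Type := Setoid (Fin k ⊕ Fin k)

namespace PartitionDiagram

variable {k : ℕ}

/-- The vertices of three stacked rows: top row, middle row, bottom row. -/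
abbrev Rows (k : ℕ) : Type := Fin k ⊕ Fin k ⊕ Fin k

/-- The inclusion of a diagram as the top and middle rows. -/
def upper : Fin k ⊕ Fin k → Rows k := Sum.elim Sum.inl (Sum.inr ∘ Sum.inl)

/-- The inclusion of a diagram as the middle and bottom rows. -/
def lower : Fin k ⊕ Fin k → Rows k := Sum.elim (Sum.inr ∘ Sum.inl) (Sum.inr ∘ Sum.inr)

/-- The inclusion of a diagram as the top and bottom rows. -/
def outer : Fin k ⊕ Fin k → Rows k := Sum.elim Sum.inl (Sum.inr ∘ Sum.inr)

/-- The connected components of the graph obtained by placing `ρ₁` above `ρ₂` and identifying the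
bottom row of `ρ₁` with the top row of `ρ₂`. -/
def stack (ρ₁ ρ₂ : PartitionDiagram k) : Setoid (Rows k) :=
  ρ₁.map upper ⊔ ρ₂.map lower

/-- The composition `ρ₁ ∘ ρ₂`: the partition which the stacked diagram induces on the top and
bottom rows. -/
@[reducible]
def comp (ρ₁ ρ₂ : PartitionDiagram k) : PartitionDiagram k :=
  (stack ρ₁ ρ₂).comap outer

/-- The components of the stacked diagram that consist of middle row vertices only. -/
def InnerBlock (ρ₁ ρ₂ : PartitionDiagram k) : Type :=
  {c : Quotient (stack ρ₁ ρ₂) // ∀ v : Fin k ⊕ Fin k, Quotient.mk _ (outer v) ≠ c}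

/-- The number `ℓ` of blocks removed from the middle row in forming `ρ₁ ∘ ρ₂`. -/
noncomputable def removed (ρ₁ ρ₂ : PartitionDiagram k) : ℕ := Nat.card (InnerBlock ρ₁ ρ₂)

/-- The identity diagram, with blocks `{j, j'}`. -/
@[reducible]
def one (k : ℕ) : PartitionDiagram k := Setoid.ker (Sum.elim id id)

/-- The label of a vertex: `j` for both `j` and `j'`, with `1 ≤ j ≤ k`. -/
def idx : Fin k ⊕ Fin k → ℕ := Sum.elim (fun a => a.val + 1) (fun a => a.val + 1)

/-- The diagram `s_i`, for `1 ≤ i < k`: its blocks are `{i, (i+1)'}`, `{i+1, i'}` and `{j, j'}` for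
`j ≠ i, i+1`. -/
@[reducible]
def s (k i : ℕ) : PartitionDiagram k :=
  Setoid.ker (Sum.elim (fun a => a.val + 1) (fun a => Equiv.swap i (i + 1) (a.val + 1)))

/-- The diagram `p_j`, for `1 ≤ j ≤ k`: its blocks are `{j}`, `{j'}` and `{l, l'}` for `l ≠ j`. -/
@[reducible]
def p (k j : ℕ) : PartitionDiagram k :=
  Setoid.ker (fun v => (idx v, decide (idx v = j) && v.isRight))

/-- The diagram `p_{i+1/2}`, for `1 ≤ i < k`: its blocks are `{i, i+1, i', (i+1)'}` and `{j, j'}`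
for `j ≠ i, i+1`. -/
@[reducible]
def pHalf (k i : ℕ) : PartitionDiagram k :=
  Setoid.ker (fun v => if idx v = i + 1 then i else idx v)

/-! Composition is associative and unital, and the numbers of removed blocks are compatible with
this.  This is checked by counting two-valued labellings that are constant on blocks. -/

theorem stack_le_iff {ρ₁ ρ₂ : PartitionDiagram k} {t : Setoid (Rows k)} :
    stack ρ₁ ρ₂ ≤ t ↔ ρ₁ ≤ t.comap upper ∧ ρ₂ ≤ t.comap lower := by
  have key : ∀ (r : PartitionDiagram k) (f : Fin k ⊕ Fin k → Rows k),
      r.map f ≤ t ↔ r ≤ t.comap f := by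
    intro r f
    constructor
    · intro h x y hxy
      exact h (Setoid.le_comap_map hxy)
    · intro h
      refine Setoid.eqvGen_le ?_
      rintro _ _ ⟨a, b, hab, rfl, rfl⟩
      exact h hab
  rw [stack, sup_le_iff, key, key]

open Classical in
/-- The zero-one matrix recording which pairs of labellings are constant on the blocks. -/
noncomputable def labelMatrix (ρ : PartitionDiagram k) :
    Matrix (Fin k → Bool) (Fin k → Bool) ℕ :=
  fun f g => if ρ ≤ Setoid.ker (Sum.elim f g) then 1 else 0

/-- Labellings of the middle row compatible with a fixed labelling of the outer rows correspond to
labellings of the inner blocks. -/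
theorem card_middle (ρ₁ ρ₂ : PartitionDiagram k) (f g : Fin k → Bool)
    (h : comp ρ₁ ρ₂ ≤ Setoid.ker (Sum.elim f g)) :
    Nat.card {m : Fin k → Bool // stack ρ₁ ρ₂ ≤ Setoid.ker (Sum.elim f (Sum.elim m g))} =
      2 ^ removed ρ₁ ρ₂ := by
  classical
  let F : (Fin k → Bool) → Rows k → Bool := fun m => Sum.elim f (Sum.elim m g)
  have hout : ∀ m v, F m (outer v) = Sum.elim f g v := by
    rintro m (a | a) <;> rfl
  let q : Rows k → Quotient (stack ρ₁ ρ₂) := Quotient.mk _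
  let val : (InnerBlock ρ₁ ρ₂ → Bool) → Rows k → Bool := fun φ x =>
    if hx : ∃ v, q (outer v) = q x then Sum.elim f g hx.choose
    else φ ⟨q x, fun v hv => hx ⟨v, hv⟩⟩
  have hval : ∀ φ v, val φ (outer v) = Sum.elim f g v := by
    intro φ v
    have hx : ∃ w, q (outer w) = q (outer v) := ⟨v, rfl⟩
    simp only [val, dif_pos hx]
    exact h (show stack ρ₁ ρ₂ (outer hx.choose) (outer v) from Quotient.exact hx.choose_spec)
  have hresp : ∀ φ x y, stack ρ₁ ρ₂ x y → val φ x = val φ y := by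
    intro φ x y hxy
    have : q x = q y := Quotient.sound hxy
    simp only [val, this]
  let mid : Fin k → Rows k := fun a => Sum.inr (Sum.inl a)
  have hF : ∀ φ, F (fun a => val φ (mid a)) = val φ := by
    intro φ
    funext x
    rcases x with a | a | a
    · exact (hval φ (Sum.inl a)).symm
    · rfl
    · exact (hval φ (Sum.inr a)).symm
  let e : {m : Fin k → Bool // stack ρ₁ ρ₂ ≤ Setoid.ker (F m)} ≃ (InnerBlock ρ₁ ρ₂ → Bool) :=
    { toFun := fun m c => Quotient.lift (F m.1) (fun _ _ hxy => m.2 hxy) c.1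
      invFun := fun φ => ⟨fun a => val φ (mid a), by
        rw [hF]
        intro x y hxy
        exact hresp φ x y hxy⟩
      left_inv := by
        rintro ⟨m, hm⟩
        apply Subtype.ext
        funext a
        simp only [val]
        split_ifs with hx
        · have h1 : F m (outer hx.choose) = F m (mid a) := hm (Quotient.exact hx.choose_spec)
          rw [hout] at h1
          exact h1
        · rfl
      right_inv := by
        intro φ
        funext ⟨c, hc⟩
        induction c using Quotient.inductionOn with
        | h x =>
          change F (fun a => val φ (mid a)) x = _
          rw [hF]
          have hx : ¬ ∃ v, q (outer v) = q x := fun ⟨v, hv⟩ => hc v hv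
          simp only [val, dif_neg hx]
          rfl }
  have : Finite (InnerBlock ρ₁ ρ₂) := by unfold InnerBlock; infer_instance
  rw [Nat.card_congr e, Nat.card_fun, Nat.card_eq_fintype_card, Fintype.card_bool, removed]

theorem labelMatrix_mul (ρ₁ ρ₂ : PartitionDiagram k) :
    labelMatrix ρ₁ * labelMatrix ρ₂ = 2 ^ removed ρ₁ ρ₂ • labelMatrix (comp ρ₁ ρ₂) := by
  classical
  ext f g
  have hiff : ∀ m : Fin k → Bool,
      (ρ₁ ≤ Setoid.ker (Sum.elim f m) ∧ ρ₂ ≤ Setoid.ker (Sum.elim m g)) ↔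
        stack ρ₁ ρ₂ ≤ Setoid.ker (Sum.elim f (Sum.elim m g)) := by
    intro m
    rw [stack_le_iff]
    have e1 : (Setoid.ker (Sum.elim f (Sum.elim m g))).comap upper
        = Setoid.ker (Sum.elim f m) := by
      ext x y
      rcases x with x | x <;> rcases y with y | y <;> rfl
    have e2 : (Setoid.ker (Sum.elim f (Sum.elim m g))).comap lower
        = Setoid.ker (Sum.elim m g) := by
      ext x y
      rcases x with x | x <;> rcases y with y | y <;> rfl
    rw [e1, e2]
  have hsum : (labelMatrix ρ₁ * labelMatrix ρ₂) f g =
      Nat.card {m : Fin k → Bool // stack ρ₁ ρ₂ ≤ Setoid.ker (Sum.elim f (Sum.elim m g))} := by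
    rw [Matrix.mul_apply, Nat.card_eq_fintype_card, Fintype.card_subtype, Finset.card_filter]
    refine Finset.sum_congr rfl fun m _ => ?_
    rw [← if_congr (hiff m) rfl rfl, labelMatrix, labelMatrix]
    by_cases h1 : ρ₁ ≤ Setoid.ker (Sum.elim f m) <;>
      by_cases h2 : ρ₂ ≤ Setoid.ker (Sum.elim m g) <;> simp [h1, h2]
  rw [hsum, Matrix.smul_apply]
  by_cases h : comp ρ₁ ρ₂ ≤ Setoid.ker (Sum.elim f g)
  · rw [card_middle ρ₁ ρ₂ f g h, labelMatrix, if_pos h, smul_eq_mul, mul_one]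
  · rw [labelMatrix, if_neg h, smul_zero]
    have : IsEmpty {m : Fin k → Bool //
        stack ρ₁ ρ₂ ≤ Setoid.ker (Sum.elim f (Sum.elim m g))} := by
      refine ⟨fun ⟨m, hm⟩ => h ?_⟩
      intro x y hxy
      have h1 := hm (show stack ρ₁ ρ₂ (outer x) (outer y) from hxy)
      rcases x with x | x <;> rcases y with y | y <;> exact h1
    exact Nat.card_of_isEmpty

theorem labelMatrix_const (ρ : PartitionDiagram k) :
    labelMatrix ρ (fun _ => true) (fun _ => true) = 1 := by
  rw [labelMatrix, if_pos]
  intro x y _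
  rcases x with x | x <;> rcases y with y | y <;> rfl

theorem labelMatrix_injective : Function.Injective (labelMatrix (k := k)) := by
  classical
  have key : ∀ ρ τ : PartitionDiagram k, labelMatrix ρ = labelMatrix τ → τ ≤ ρ := by
    intro ρ τ h x y hxy
    let L : Fin k ⊕ Fin k → Bool := fun v => decide (ρ x v)
    have hL : Sum.elim (L ∘ Sum.inl) (L ∘ Sum.inr) = L := Sum.elim_comp_inl_inr L
    have h1 : ρ ≤ Setoid.ker L := by
      intro a b hab
      have : ρ x a ↔ ρ x b := ⟨fun h => ρ.trans h hab, fun h => ρ.trans h (ρ.symm hab)⟩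
      simp [Setoid.ker_def, L, this]
    have h2 := congrFun (congrFun h (L ∘ Sum.inl)) (L ∘ Sum.inr)
    simp only [labelMatrix, hL, if_pos h1] at h2
    have h3 : τ ≤ Setoid.ker L := by
      by_contra h3
      rw [if_neg h3] at h2
      exact one_ne_zero h2
    have h4 : L x = L y := h3 hxy
    have h5 : L x = true := decide_eq_true (ρ.refl x)
    exact of_decide_eq_true (h4.symm.trans h5)
  intro ρ τ h
  exact le_antisymm (key τ ρ h.symm) (key ρ τ h)

theorem eq_of_smul_labelMatrix_eq {m n : ℕ} {ρ τ : PartitionDiagram k}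
    (h : 2 ^ m • labelMatrix ρ = 2 ^ n • labelMatrix τ) : m = n ∧ ρ = τ := by
  have h1 := congrFun (congrFun h (fun _ => true)) (fun _ => true)
  simp only [Matrix.smul_apply, labelMatrix_const, smul_eq_mul, mul_one] at h1
  have hmn : m = n := Nat.pow_right_injective le_rfl h1
  subst hmn
  refine ⟨rfl, labelMatrix_injective ?_⟩
  ext f g
  have h2 := congrFun (congrFun h f) g
  simp only [Matrix.smul_apply, smul_eq_mul] at h2
  exact Nat.eq_of_mul_eq_mul_left (by positivity) h2

theorem labelMatrix_one : labelMatrix (one k) = 1 := by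
  classical
  ext f g
  rw [labelMatrix, Matrix.one_apply]
  refine if_congr ⟨fun h => ?_, ?_⟩ rfl rfl
  · funext a
    exact h (show one k (Sum.inl a) (Sum.inr a) from rfl)
  · rintro rfl x y hxy
    rcases x with x | x <;> rcases y with y | y <;> exact congrArg f hxy

theorem comp_assoc (a b c : PartitionDiagram k) :
    removed a b + removed (comp a b) c = removed b c + removed a (comp b c) ∧
      comp (comp a b) c = comp a (comp b c) := by
  have h := mul_assoc (labelMatrix a) (labelMatrix b) (labelMatrix c)
  rw [labelMatrix_mul, labelMatrix_mul, Matrix.smul_mul, Matrix.mul_smul, labelMatrix_mul,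
    labelMatrix_mul, smul_smul, smul_smul, ← pow_add, ← pow_add] at h
  exact eq_of_smul_labelMatrix_eq h

theorem one_comp (a : PartitionDiagram k) : removed (one k) a = 0 ∧ comp (one k) a = a := by
  have h := labelMatrix_mul (one k) a
  rw [labelMatrix_one, one_mul] at h
  refine eq_of_smul_labelMatrix_eq ?_
  rw [← h, pow_zero, one_smul]

theorem comp_one (a : PartitionDiagram k) : removed a (one k) = 0 ∧ comp a (one k) = a := by
  have h := labelMatrix_mul a (one k)
  rw [labelMatrix_one, mul_one] at h
  refine eq_of_smul_labelMatrix_eq ?_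
  rw [← h, pow_zero, one_smul]

end PartitionDiagram

/-- The partition algebra `𝒜_k(z)` over `R`: the free `R`-module on the partition diagrams on `k`
strands, with product `ρ₁ρ₂ = z ^ ℓ • (ρ₁ ∘ ρ₂)`. -/
def PartitionAlgebra (R : Type*) [CommRing R] (_z : R) (k : ℕ) : Type _ :=
  PartitionDiagram k →₀ R

namespace PartitionAlgebra

section Algebra

variable {R : Type*} [CommRing R] {z : R} {k : ℕ}

noncomputable instance : AddCommGroup (PartitionAlgebra R z k) :=
  inferInstanceAs (AddCommGroup (PartitionDiagram k →₀ R))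

noncomputable instance : Module R (PartitionAlgebra R z k) :=
  inferInstanceAs (Module R (PartitionDiagram k →₀ R))

/-- The diagram basis of the partition algebra. -/
noncomputable def basis (R : Type*) [CommRing R] (z : R) (k : ℕ) :
    Module.Basis (PartitionDiagram k) R (PartitionAlgebra R z k) :=
  Module.Basis.ofRepr (LinearEquiv.refl R (PartitionDiagram k →₀ R))

/-- The bilinear product, determined by its values on the diagram basis. -/
noncomputable def mulLin (R : Type*) [CommRing R] (z : R) (k : ℕ) :
    PartitionAlgebra R z k →ₗ[R] PartitionAlgebra R z k →ₗ[R] PartitionAlgebra R z k :=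
  (basis R z k).constr R fun a => (basis R z k).constr R fun b =>
    z ^ PartitionDiagram.removed a b • basis R z k (PartitionDiagram.comp a b)

theorem mulLin_basis (a b : PartitionDiagram k) :
    mulLin R z k (basis R z k a) (basis R z k b) =
      z ^ PartitionDiagram.removed a b • basis R z k (PartitionDiagram.comp a b) := by
  simp only [mulLin, Module.Basis.constr_basis]

theorem mulLin_assoc (x y w : PartitionAlgebra R z k) :
    mulLin R z k (mulLin R z k x y) w = mulLin R z k x (mulLin R z k y w) := by
  let l : PartitionAlgebra R z k →ₗ[R] PartitionAlgebra R z k →ₗ[R]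
      PartitionAlgebra R z k →ₗ[R] PartitionAlgebra R z k :=
    (mulLin R z k).compr₂ (mulLin R z k)
  let r : PartitionAlgebra R z k →ₗ[R] PartitionAlgebra R z k →ₗ[R]
      PartitionAlgebra R z k →ₗ[R] PartitionAlgebra R z k :=
    (LinearMap.llcomp R _ _ _).flip (mulLin R z k) ∘ₗ
      (LinearMap.llcomp R (PartitionAlgebra R z k) (PartitionAlgebra R z k)
        (PartitionAlgebra R z k)) ∘ₗ mulLin R z k
  have h : l = r := by
    refine (basis R z k).ext fun a => (basis R z k).ext fun b => (basis R z k).ext fun c => ?_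
    change mulLin R z k (mulLin R z k (basis R z k a) (basis R z k b)) (basis R z k c) =
      mulLin R z k (basis R z k a) (mulLin R z k (basis R z k b) (basis R z k c))
    obtain ⟨h1, h2⟩ := PartitionDiagram.comp_assoc a b c
    simp only [mulLin_basis, map_smul, LinearMap.smul_apply, smul_smul, ← pow_add, h1, h2]
  exact congrArg (fun t => t x y w) h

noncomputable instance : Mul (PartitionAlgebra R z k) := ⟨fun x y => mulLin R z k x y⟩

noncomputable instance : One (PartitionAlgebra R z k) :=
  ⟨basis R z k (PartitionDiagram.one k)⟩

theorem one_def : (1 : PartitionAlgebra R z k) = basis R z k (PartitionDiagram.one k) := rfl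

theorem mul_def (x y : PartitionAlgebra R z k) : x * y = mulLin R z k x y := rfl

theorem basis_mul_basis (a b : PartitionDiagram k) :
    basis R z k a * basis R z k b =
      z ^ PartitionDiagram.removed a b • basis R z k (PartitionDiagram.comp a b) :=
  mulLin_basis a b

noncomputable instance : Ring (PartitionAlgebra R z k) :=
  { (inferInstance : AddCommGroup (PartitionAlgebra R z k)) with
    mul := (· * ·)
    one := 1
    left_distrib := fun x y w => map_add (mulLin R z k x) y w
    right_distrib := fun x y w => LinearMap.map_add₂ (mulLin R z k) x y w
    zero_mul := fun x => LinearMap.map_zero₂ (mulLin R z k) x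
    mul_zero := fun x => map_zero (mulLin R z k x)
    mul_assoc := mulLin_assoc
    one_mul := fun x => by
      have h : mulLin R z k (basis R z k (PartitionDiagram.one k)) = LinearMap.id := by
        refine (basis R z k).ext fun a => ?_
        obtain ⟨h1, h2⟩ := PartitionDiagram.one_comp a
        rw [mulLin_basis, h1, h2, pow_zero, one_smul, LinearMap.id_apply]
      exact congrArg (fun t => t x) h
    mul_one := fun x => by
      have h : (mulLin R z k).flip (basis R z k (PartitionDiagram.one k)) = LinearMap.id := by
        refine (basis R z k).ext fun a => ?_
        obtain ⟨h1, h2⟩ := PartitionDiagram.comp_one a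
        rw [LinearMap.flip_apply, mulLin_basis, h1, h2, pow_zero, one_smul, LinearMap.id_apply]
      exact congrArg (fun t => t x) h }

noncomputable instance : Algebra R (PartitionAlgebra R z k) :=
  Algebra.ofModule (fun r x y => LinearMap.map_smul₂ (mulLin R z k) r x y)
    (fun r x y => map_smul (mulLin R z k x) r y)

end Algebra

section JucysMurphy

variable (R : Type*) [CommRing R] (z : R) (k : ℕ)

/-- The generator `s_i` (`1 ≤ i < k`) of the partition algebra. -/
noncomputable def s (i : ℕ) : PartitionAlgebra R z k := basis R z k (PartitionDiagram.s k i)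

/-- The generator `p_j` (`1 ≤ j ≤ k`) of the partition algebra. -/
noncomputable def p (j : ℕ) : PartitionAlgebra R z k := basis R z k (PartitionDiagram.p k j)

/-- The generator `p_{i+1/2}` (`1 ≤ i < k`) of the partition algebra. -/
noncomputable def pHalf (i : ℕ) : PartitionAlgebra R z k :=
  basis R z k (PartitionDiagram.pHalf k i)

/-- The expression for `σ_{i+1}` (`i ≥ 2`) in terms of `S = σ_i` and `M = L_{i-1}`. -/
noncomputable def sigmaStep (i : ℕ) (S M : PartitionAlgebra R z k) : PartitionAlgebra R z k :=
  s R z k (i - 1) * s R z k i * S * s R z k i * s R z k (i - 1)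
    + s R z k i * pHalf R z k (i - 1) * M * s R z k i * pHalf R z k (i - 1) * s R z k i
    + pHalf R z k (i - 1) * M * s R z k i * pHalf R z k (i - 1)
    - s R z k i * pHalf R z k (i - 1) * M * s R z k (i - 1) * pHalf R z k i * p R z k i
        * pHalf R z k (i - 1)
    - pHalf R z k (i - 1) * p R z k i * pHalf R z k i * s R z k (i - 1) * M
        * pHalf R z k (i - 1) * s R z k i

/-- The expression for `L_{i+1}` (`i ≥ 1`) in terms of `M = L_i` and `S = σ_{i+1}`. -/
noncomputable def LStep (i : ℕ) (M S : PartitionAlgebra R z k) : PartitionAlgebra R z k :=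
  -(s R z k i * M * pHalf R z k i) - pHalf R z k i * M * s R z k i
    + pHalf R z k i * M * p R z k (i + 1) * pHalf R z k i
    + s R z k i * M * s R z k i + S

/-- The expression for `σ_{i+1/2}` (`i ≥ 2`) in terms of `S = σ_{i-1/2}` and `M = L_{i-1}`. -/
noncomputable def sigmaHalfStep (i : ℕ) (S M : PartitionAlgebra R z k) :
    PartitionAlgebra R z k :=
  s R z k (i - 1) * s R z k i * S * s R z k i * s R z k (i - 1)
    + pHalf R z k (i - 1) * M * s R z k i * pHalf R z k (i - 1) * s R z k i
    + s R z k i * pHalf R z k (i - 1) * M * s R z k i * pHalf R z k (i - 1)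
    - pHalf R z k (i - 1) * M * s R z k (i - 1) * pHalf R z k i * p R z k i
        * pHalf R z k (i - 1)
    - s R z k i * pHalf R z k (i - 1) * p R z k i * pHalf R z k i * s R z k (i - 1) * M
        * pHalf R z k (i - 1) * s R z k i

/-- The simultaneous recursion: the `n`-th term is the pair `(L_n, σ_{n+1})`. -/
noncomputable def LSigma : ℕ → PartitionAlgebra R z k × PartitionAlgebra R z k
  | 0 => (0, 1)
  | 1 => (p R z k 1, s R z k 1)
  | n + 2 => (LStep R z k (n + 1) (LSigma (n + 1)).1 (LSigma (n + 1)).2,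
      sigmaStep R z k (n + 2) (LSigma (n + 1)).2 (LSigma (n + 1)).1)

/-- The Jucys–Murphy element `L_i`, as an element of `𝒜_k(z)` for `i ≤ k`. -/
noncomputable def L (i : ℕ) : PartitionAlgebra R z k := (LSigma R z k i).1

/-- The element `σ_i`, as an element of `𝒜_k(z)` for `1 ≤ i ≤ k`; the value at `0` is unused. -/
noncomputable def sigma : ℕ → PartitionAlgebra R z k
  | 0 => 1
  | n + 1 => (LSigma R z k n).2

/-- The element `sigmaHalf i = σ_{i+1/2}`, as an element of `𝒜_k(z)` for `i < k`. -/
noncomputable def sigmaHalf : ℕ → PartitionAlgebra R z k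
  | 0 => 1
  | 1 => 1
  | n + 2 => sigmaHalfStep R z k (n + 2) (sigmaHalf (n + 1)) (L R z k (n + 1))

/-! The initial values and recursions, in the usual indexing. -/

theorem L_zero : L R z k 0 = 0 := by simp only [L, LSigma]

theorem L_one : L R z k 1 = p R z k 1 := by simp only [L, LSigma]

theorem sigma_one : sigma R z k 1 = 1 := by simp only [sigma, LSigma]

theorem sigma_two : sigma R z k 2 = s R z k 1 := by simp only [sigma, LSigma]

theorem L_succ (i : ℕ) (hi : 1 ≤ i) :
    L R z k (i + 1) = LStep R z k i (L R z k i) (sigma R z k (i + 1)) := by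
  obtain ⟨n, rfl⟩ := Nat.exists_eq_add_of_le' hi
  simp only [L, sigma, LSigma]

theorem sigma_succ (i : ℕ) (hi : 2 ≤ i) :
    sigma R z k (i + 1) = sigmaStep R z k i (sigma R z k i) (L R z k (i - 1)) := by
  obtain ⟨n, rfl⟩ := Nat.exists_eq_add_of_le' hi
  simp only [L, sigma, LSigma, Nat.add_succ_sub_one]

theorem sigmaHalf_zero : sigmaHalf R z k 0 = 1 := by simp only [sigmaHalf]

theorem sigmaHalf_one : sigmaHalf R z k 1 = 1 := by simp only [sigmaHalf]

theorem sigmaHalf_eq (i : ℕ) (hi : 2 ≤ i) :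
    sigmaHalf R z k i =
      sigmaHalfStep R z k i (sigmaHalf R z k (i - 1)) (L R z k (i - 1)) := by
  obtain ⟨n, rfl⟩ := Nat.exists_eq_add_of_le' hi
  simp only [sigmaHalf, Nat.add_succ_sub_one]

end JucysMurphy

end PartitionAlgebra

/-! The proof goes through tensor space. For every `n`, setting `z = n` makes $\mathcal{A}_k(z)$ act
on integer functions of words of length `k` in `n` letters. Once `n ≥ 2 * k` the diagrams act
linearly independently, and an integer polynomial with infinitely many roots is zero. So these
actions are jointly faithful (`eq_zero_of_tensorRep_eq_zero`), and an identity may be checked on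
words.

On words the elements have closed forms. $L_{m+1}$ sums over all letters `b`, applying the
transposition of the letter in position `m + 1` with `b` to the first `m + 1` positions.
$\sigma_{m+2}$ applies the transposition of the letters in positions `m + 1` and `m + 2` to the
first `m + 2` positions, and $\sigma_{m+3/2}$ applies the same transposition to the first `m`
positions only. The recursions preserve these descriptions (`ActsAsL.LStep`, `ActsAsL.sigmaStep`,
`ActsAsL.sigmaHalfStep`). Since $\sigma$ either exchanges or fixes the two letters that determine
its transposition, a second application uses the same transposition and undoes the first. -/

namespace PartitionDiagram

/-! ### Labelling matrices: products and linear independence. -/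

variable {k : ℕ}

open Classical in
/-- The zero-one matrix over `ℤ` recording which pairs of labellings by `α` are constant on the
blocks of a diagram. -/
noncomputable def labellingMatrix (α : Type*) (ρ : PartitionDiagram k) :
    Matrix (Fin k → α) (Fin k → α) ℤ :=
  fun f g => if ρ ≤ Setoid.ker (Sum.elim f g) then 1 else 0

/-- Labellings of the middle row compatible with a fixed labelling of the outer rows correspond to
labellings of the inner blocks. -/
theorem card_middle_labellings {α : Type*} [Finite α] (ρ₁ ρ₂ : PartitionDiagram k)
    (f g : Fin k → α) (h : comp ρ₁ ρ₂ ≤ Setoid.ker (Sum.elim f g)) :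
    Nat.card {m : Fin k → α // stack ρ₁ ρ₂ ≤ Setoid.ker (Sum.elim f (Sum.elim m g))} =
      Nat.card α ^ removed ρ₁ ρ₂ := by
  classical
  let F : (Fin k → α) → Rows k → α := fun m => Sum.elim f (Sum.elim m g)
  have hout : ∀ m v, F m (outer v) = Sum.elim f g v := by
    rintro m (a | a) <;> rfl
  let q : Rows k → Quotient (stack ρ₁ ρ₂) := Quotient.mk _
  let val : (InnerBlock ρ₁ ρ₂ → α) → Rows k → α := fun φ x =>
    if hx : ∃ v, q (outer v) = q x then Sum.elim f g hx.choose
    else φ ⟨q x, fun v hv => hx ⟨v, hv⟩⟩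
  have hval : ∀ φ v, val φ (outer v) = Sum.elim f g v := by
    intro φ v
    have hx : ∃ w, q (outer w) = q (outer v) := ⟨v, rfl⟩
    simp only [val, dif_pos hx]
    exact h (show stack ρ₁ ρ₂ (outer hx.choose) (outer v) from Quotient.exact hx.choose_spec)
  have hresp : ∀ φ x y, stack ρ₁ ρ₂ x y → val φ x = val φ y := by
    intro φ x y hxy
    have : q x = q y := Quotient.sound hxy
    simp only [val, this]
  let mid : Fin k → Rows k := fun a => Sum.inr (Sum.inl a)
  have hF : ∀ φ, F (fun a => val φ (mid a)) = val φ := by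
    intro φ
    funext x
    rcases x with a | a | a
    · exact (hval φ (Sum.inl a)).symm
    · rfl
    · exact (hval φ (Sum.inr a)).symm
  let e : {m : Fin k → α // stack ρ₁ ρ₂ ≤ Setoid.ker (F m)} ≃ (InnerBlock ρ₁ ρ₂ → α) :=
    { toFun := fun m c => Quotient.lift (F m.1) (fun _ _ hxy => m.2 hxy) c.1
      invFun := fun φ => ⟨fun a => val φ (mid a), by
        rw [hF]
        intro x y hxy
        exact hresp φ x y hxy⟩
      left_inv := by
        rintro ⟨m, hm⟩
        apply Subtype.ext
        funext a
        simp only [val]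
        split_ifs with hx
        · have h1 : F m (outer hx.choose) = F m (mid a) := hm (Quotient.exact hx.choose_spec)
          rw [hout] at h1
          exact h1
        · rfl
      right_inv := by
        intro φ
        funext ⟨c, hc⟩
        induction c using Quotient.inductionOn with
        | h x =>
          change F (fun a => val φ (mid a)) x = _
          rw [hF]
          have hx : ¬ ∃ v, q (outer v) = q x := fun ⟨v, hv⟩ => hc v hv
          simp only [val, dif_neg hx]
          rfl }
  have : Finite (InnerBlock ρ₁ ρ₂) := by unfold InnerBlock; infer_instance
  rw [Nat.card_congr e, Nat.card_fun, removed]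

/-- An entry of the product counts the compatible labellings of the middle row. Each removed block
is labelled freely, which is why `z` must become the number of labels. -/
theorem labellingMatrix_mul {α : Type*} [Fintype α] (ρ₁ ρ₂ : PartitionDiagram k) :
    labellingMatrix α ρ₁ * labellingMatrix α ρ₂ =
      ((Fintype.card α : ℤ) ^ removed ρ₁ ρ₂) • labellingMatrix α (comp ρ₁ ρ₂) := by
  classical
  ext f g
  have hiff : ∀ m : Fin k → α,
      (ρ₁ ≤ Setoid.ker (Sum.elim f m) ∧ ρ₂ ≤ Setoid.ker (Sum.elim m g)) ↔
        stack ρ₁ ρ₂ ≤ Setoid.ker (Sum.elim f (Sum.elim m g)) := by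
    intro m
    rw [stack_le_iff]
    have e1 : (Setoid.ker (Sum.elim f (Sum.elim m g))).comap upper
        = Setoid.ker (Sum.elim f m) := by
      ext x y
      rcases x with x | x <;> rcases y with y | y <;> rfl
    have e2 : (Setoid.ker (Sum.elim f (Sum.elim m g))).comap lower
        = Setoid.ker (Sum.elim m g) := by
      ext x y
      rcases x with x | x <;> rcases y with y | y <;> rfl
    rw [e1, e2]
  have hsum : (labellingMatrix α ρ₁ * labellingMatrix α ρ₂) f g =
      Nat.card {m : Fin k → α // stack ρ₁ ρ₂ ≤ Setoid.ker (Sum.elim f (Sum.elim m g))} := by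
    rw [Matrix.mul_apply, Nat.card_eq_fintype_card, Fintype.card_subtype, Finset.card_filter,
      Nat.cast_sum]
    refine Finset.sum_congr rfl fun m _ => ?_
    rw [← if_congr (hiff m) rfl rfl, labellingMatrix, labellingMatrix]
    by_cases h1 : ρ₁ ≤ Setoid.ker (Sum.elim f m) <;>
      by_cases h2 : ρ₂ ≤ Setoid.ker (Sum.elim m g) <;> simp [h1, h2]
  rw [hsum, Matrix.smul_apply]
  by_cases h : comp ρ₁ ρ₂ ≤ Setoid.ker (Sum.elim f g)
  · rw [card_middle_labellings ρ₁ ρ₂ f g h, labellingMatrix, if_pos h, smul_eq_mul, mul_one,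
      Nat.card_eq_fintype_card, Nat.cast_pow]
  · rw [labellingMatrix, if_neg h, smul_zero]
    have : IsEmpty {m : Fin k → α //
        stack ρ₁ ρ₂ ≤ Setoid.ker (Sum.elim f (Sum.elim m g))} := by
      refine ⟨fun ⟨m, hm⟩ => h ?_⟩
      intro x y hxy
      have h1 := hm (show stack ρ₁ ρ₂ (outer x) (outer y) from hxy)
      rcases x with x | x <;> rcases y with y | y <;> exact h1
    rw [Nat.card_of_isEmpty, Nat.cast_zero]

theorem labellingMatrix_one {α : Type*} [DecidableEq α] : labellingMatrix α (one k) = 1 := by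
  classical
  ext f g
  rw [labellingMatrix, Matrix.one_apply]
  refine if_congr ⟨fun h => ?_, ?_⟩ rfl rfl
  · funext a
    exact h (show one k (Sum.inl a) (Sum.inr a) from rfl)
  · rintro rfl x y hxy
    rcases x with x | x <;> rcases y with y | y <;> exact congrArg f hxy

/-- Triangularity for the refinement order: at a labelling whose level sets are exactly the blocks
of `ρ`, only diagrams `τ ≤ ρ` contribute, and the coefficients of the strictly finer ones vanish by
induction. -/
theorem linearIndependent_labellingMatrix {n : ℕ} (hn : 2 * k ≤ n) (c : PartitionDiagram k →₀ ℤ)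
    (hc : (c.sum fun ρ a => a • labellingMatrix (Fin n) ρ) = 0) : c = 0 := by
  classical
  have : Finite (PartitionDiagram k) :=
    Finite.of_injective (fun ρ : PartitionDiagram k => (fun x y => ρ x y)) fun ρ τ h =>
      Setoid.ext fun x y => iff_of_eq (congrFun (congrFun h x) y)
  ext ρ
  induction ρ using (wellFounded_lt (α := PartitionDiagram k)).induction with
  | h ρ ih =>
  -- There are at most `2 * k` blocks, so distinct blocks can get distinct labels.
  have hcard : Nat.card (Quotient ρ) ≤ Nat.card (Fin n) := by
    refine (Nat.card_le_card_of_surjective _ (Quotient.mk_surjective (s := ρ))).trans ?_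
    simpa [two_mul] using hn
  obtain ⟨e⟩ : Nonempty (Quotient ρ ↪ Fin n) := by
    have := Fintype.ofFinite (Quotient ρ)
    rw [Nat.card_eq_fintype_card, Nat.card_eq_fintype_card] at hcard
    exact Function.Embedding.nonempty_of_card_le hcard
  let l : Fin k ⊕ Fin k → Fin n := fun v => e (Quotient.mk _ v)
  have hl : Setoid.ker (Sum.elim (l ∘ Sum.inl) (l ∘ Sum.inr)) = ρ := by
    rw [Sum.elim_comp_inl_inr]
    ext x y
    exact e.injective.eq_iff.trans Quotient.eq
  have h := congrFun (congrFun hc (l ∘ Sum.inl)) (l ∘ Sum.inr)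
  rw [Finsupp.sum, Matrix.sum_apply] at h
  simp only [Matrix.smul_apply, labellingMatrix, hl, Matrix.zero_apply] at h
  rw [Finset.sum_eq_single ρ] at h
  · simpa using h
  · intro τ _ hτ
    by_cases hle : τ ≤ ρ
    · simp [ih τ (lt_of_le_of_ne hle hτ)]
    · simp [hle]
  · intro hρ
    simp [Finsupp.notMem_support_iff.1 hρ]

end PartitionDiagram

/-! ### The tensor space representation and its joint faithfulness. -/

namespace PartitionAlgebra

open Polynomial PartitionDiagram

variable {k : ℕ}

/-- The action of the partition algebra on tensor space: `z` is specialized to the number of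
labels. -/
noncomputable def tensorRepAux (α : Type*) [Fintype α] (k : ℕ) :
    PartitionAlgebra ℤ[X] X k →+ Matrix (Fin k → α) (Fin k → α) ℤ :=
  Finsupp.liftAddHom fun ρ : PartitionDiagram k =>
    ((AddMonoidHom.flip (smulAddHom ℤ _)) (labellingMatrix α ρ)).comp
      (evalRingHom (Fintype.card α : ℤ)).toAddMonoidHom

theorem tensorRepAux_apply (α : Type*) [Fintype α] (x : PartitionAlgebra ℤ[X] X k) :
    tensorRepAux α k x = Finsupp.sum (x : PartitionDiagram k →₀ ℤ[X]) fun ρ a =>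
      a.eval (Fintype.card α : ℤ) • labellingMatrix α ρ :=
  rfl

theorem tensorRepAux_smul_basis (α : Type*) [Fintype α] (c : ℤ[X]) (ρ : PartitionDiagram k) :
    tensorRepAux α k (c • basis _ X k ρ) =
      c.eval (Fintype.card α : ℤ) • labellingMatrix α ρ := by
  have h : c • basis ℤ[X] X k ρ = Finsupp.single ρ c := by
    exact (Finsupp.smul_single c ρ (1 : ℤ[X])).trans (by rw [smul_eq_mul, mul_one])
  rw [h]
  exact Finsupp.liftAddHom_apply_single _ _ _

theorem tensorRepAux_basis (α : Type*) [Fintype α] (ρ : PartitionDiagram k) :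
    tensorRepAux α k (basis _ X k ρ) = labellingMatrix α ρ := by
  simpa using tensorRepAux_smul_basis α 1 ρ

/-- `tensorRepAux` is only semilinear, along evaluation of polynomials, so multiplicativity is
checked on multiples of basis diagrams. -/
theorem induction_smul_basis {motive : PartitionAlgebra ℤ[X] X k → Prop}
    (x : PartitionAlgebra ℤ[X] X k) (zero : motive 0)
    (add : ∀ x y, motive x → motive y → motive (x + y))
    (smul : ∀ (c : ℤ[X]) ρ, motive (c • basis _ X k ρ)) : motive x := by
  have h : x ∈ Submodule.span ℤ[X] (Set.range (basis ℤ[X] X k)) := by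
    rw [(basis ℤ[X] X k).span_eq]; trivial
  induction h using Submodule.closure_induction with
  | zero => exact zero
  | add x y _ _ hx hy => exact add x y hx hy
  | smul_mem c x hx => obtain ⟨ρ, rfl⟩ := hx; exact smul c ρ

theorem tensorRepAux_mul (α : Type*) [Fintype α] (x y : PartitionAlgebra ℤ[X] X k) :
    tensorRepAux α k (x * y) = tensorRepAux α k x * tensorRepAux α k y := by
  induction x using induction_smul_basis with
  | zero => simp
  | add x x' hx hx' => rw [add_mul, map_add, map_add, add_mul, hx, hx']
  | smul c ρ =>
    induction y using induction_smul_basis with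
    | zero => simp
    | add y y' hy hy' => rw [mul_add, map_add, map_add, mul_add, hy, hy']
    | smul d τ =>
      rw [smul_mul_smul_comm, basis_mul_basis, smul_smul, tensorRepAux_smul_basis,
        tensorRepAux_smul_basis, tensorRepAux_smul_basis, smul_mul_smul_comm, labellingMatrix_mul,
        smul_smul]
      simp

/-- The tensor space representation of the partition algebra, with `z` specialized to the number
of labels. -/
noncomputable def tensorRep (α : Type*) [Fintype α] [DecidableEq α] (k : ℕ) :
    PartitionAlgebra ℤ[X] X k →+* Matrix (Fin k → α) (Fin k → α) ℤ :=
  { tensorRepAux α k with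
    map_one' := by
      change tensorRepAux α k (basis _ X k (PartitionDiagram.one k)) = 1
      rw [tensorRepAux_basis, labellingMatrix_one]
    map_mul' := tensorRepAux_mul α }

theorem tensorRep_basis (α : Type*) [Fintype α] [DecidableEq α] (ρ : PartitionDiagram k) :
    tensorRep α k (basis _ X k ρ) = labellingMatrix α ρ :=
  tensorRepAux_basis α ρ

theorem eq_zero_of_tensorRep_eq_zero (x : PartitionAlgebra ℤ[X] X k)
    (h : ∀ n : ℕ, tensorRep (Fin n) k x = 0) : x = 0 := by
  let c : PartitionDiagram k →₀ ℤ[X] := x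
  change c = 0
  ext1 ρ
  refine Polynomial.eq_zero_of_infinite_isRoot _ ?_
  -- Every integer `n ≥ 2 * k` is a root of each coefficient of `x`.
  refine Set.Infinite.mono (s := (fun n : ℕ => (n : ℤ)) '' Set.Ici (2 * k)) ?_
    ((Set.Ici_infinite _).image Nat.cast_injective.injOn)
  rintro _ ⟨n, hn, rfl⟩
  have h1 : (c.sum fun ρ a => a.eval (n : ℤ) • labellingMatrix (Fin n) ρ) = 0 := by
    have h0 : tensorRepAux (Fin n) k x = 0 := h n
    rwa [tensorRepAux_apply, Fintype.card_fin] at h0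
  have h2 := linearIndependent_labellingMatrix hn (c.mapRange (eval (n : ℤ)) eval_zero) (by
    rw [Finsupp.sum_mapRange_index (by simp)]; exact h1)
  simpa using DFunLike.congr_fun h2 ρ

end PartitionAlgebra

/-! ### The action of the generators on functions of words. -/

namespace PartitionAlgebra

open Polynomial PartitionDiagram

variable {k : ℕ} {α : Type*} [Fintype α] [DecidableEq α]

/-- The operator by which an element of the partition algebra acts on functions of words. -/
noncomputable def act (x : PartitionAlgebra ℤ[X] X k) (φ : (Fin k → α) → ℤ) : (Fin k → α) → ℤ :=
  Matrix.mulVec (tensorRep α k x) φ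

theorem act_add (x y : PartitionAlgebra ℤ[X] X k) (φ : (Fin k → α) → ℤ) (f : Fin k → α) :
    act (x + y) φ f = act x φ f + act y φ f := by
  simp [act, Matrix.add_mulVec]

theorem act_sub (x y : PartitionAlgebra ℤ[X] X k) (φ : (Fin k → α) → ℤ) (f : Fin k → α) :
    act (x - y) φ f = act x φ f - act y φ f := by
  simp [act, Matrix.sub_mulVec]

theorem act_neg (x : PartitionAlgebra ℤ[X] X k) (φ : (Fin k → α) → ℤ) (f : Fin k → α) :
    act (-x) φ f = -act x φ f := by
  simp [act, Matrix.neg_mulVec]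

/-- Evaluated at a word, the leftmost factor of a product transforms the word before the others do;
long products are thus computed by reading them from left to right. -/
theorem act_mul (x y : PartitionAlgebra ℤ[X] X k) (φ : (Fin k → α) → ℤ) :
    act (x * y) φ = act x (act y φ) := by
  simp [act]

theorem act_one (φ : (Fin k → α) → ℤ) : act (1 : PartitionAlgebra ℤ[X] X k) φ = φ := by
  simp [act]

theorem act_basis (ρ : PartitionDiagram k) (φ : (Fin k → α) → ℤ) (f : Fin k → α) :
    act (basis _ X k ρ) φ f = ∑ g, labellingMatrix α ρ f g * φ g := by
  rw [act, tensorRep_basis]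
  rfl

/-- An element acting by the identity on all tensor spaces is the identity. -/
theorem eq_one_of_act_eq (x : PartitionAlgebra ℤ[X] X k)
    (h : ∀ (n : ℕ) (φ : (Fin k → Fin n) → ℤ), act x φ = φ) : x = 1 := by
  refine sub_eq_zero.1 (eq_zero_of_tensorRep_eq_zero _ fun n => ?_)
  rw [map_sub, map_one, sub_eq_zero]
  refine Matrix.ext_of_mulVec_single fun i => ?_
  rw [Matrix.one_mulVec]
  exact h n _

theorem act_s {m : ℕ} (hm : m + 1 < k) (φ : (Fin k → α) → ℤ) (f : Fin k → α) :
    act (s _ X k (m + 1)) φ f =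
      φ (f ∘ Equiv.swap ⟨m, Nat.lt_of_succ_lt hm⟩ ⟨m + 1, hm⟩) := by
  classical
  have hswap : ∀ a : Fin k, Equiv.swap (m + 1) (m + 1 + 1) (a.val + 1) =
      (Equiv.swap (⟨m, Nat.lt_of_succ_lt hm⟩ : Fin k) ⟨m + 1, hm⟩ a).val + 1 := by
    intro a
    simp only [Equiv.swap_apply_def, Fin.ext_iff]
    split_ifs <;> simp_all
  have key : ∀ g : Fin k → α, PartitionDiagram.s k (m + 1) ≤ Setoid.ker (Sum.elim f g) ↔
      g = f ∘ Equiv.swap ⟨m, Nat.lt_of_succ_lt hm⟩ ⟨m + 1, hm⟩ := by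
    intro g
    constructor
    · intro h
      funext a
      exact (h (show PartitionDiagram.s k (m + 1) (Sum.inl _) (Sum.inr a) from
        (hswap a).symm)).symm
    · rintro rfl x y hxy
      rcases x with x | x <;> rcases y with y | y <;>
        simp only [Setoid.ker_def, Sum.elim_inl, Sum.elim_inr, hswap, Nat.add_right_cancel_iff,
          Fin.val_inj, EmbeddingLike.apply_eq_iff_eq] at hxy <;>
        simp [Setoid.ker_def, hxy]
  rw [s, act_basis]
  simp [labellingMatrix, key]

theorem act_pHalf {m : ℕ} (hm : m + 1 < k) (φ : (Fin k → α) → ℤ) (f : Fin k → α) :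
    act (pHalf _ X k (m + 1)) φ f =
      if f ⟨m, Nat.lt_of_succ_lt hm⟩ = f ⟨m + 1, hm⟩ then φ f else 0 := by
  classical
  have key : ∀ g : Fin k → α, PartitionDiagram.pHalf k (m + 1) ≤ Setoid.ker (Sum.elim f g) ↔
      g = f ∧ f ⟨m, Nat.lt_of_succ_lt hm⟩ = f ⟨m + 1, hm⟩ := by
    intro g
    constructor
    · intro h
      refine ⟨funext fun a => ?_, ?_⟩
      · exact (h (show PartitionDiagram.pHalf k (m + 1) (Sum.inl a) (Sum.inr a) from rfl)).symm
      · exact h (show PartitionDiagram.pHalf k (m + 1) (Sum.inl ⟨m, Nat.lt_of_succ_lt hm⟩)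
          (Sum.inl ⟨m + 1, hm⟩) by simp [Setoid.ker_def, idx])
    · rintro ⟨rfl, h⟩ x y hxy
      have aux : ∀ a b : Fin k, ((if a.val + 1 = m + 1 + 1 then m + 1 else a.val + 1) =
          if b.val + 1 = m + 1 + 1 then m + 1 else b.val + 1) → g a = g b := by
        intro a b hab
        by_cases ha : a = ⟨m + 1, hm⟩ <;> by_cases hb : b = ⟨m + 1, hm⟩
        · rw [ha, hb]
        · have : b = ⟨m, Nat.lt_of_succ_lt hm⟩ := by
            simp only [Fin.ext_iff] at *; split_ifs at hab <;> omega
          rw [ha, this, h]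
        · have : a = ⟨m, Nat.lt_of_succ_lt hm⟩ := by
            simp only [Fin.ext_iff] at *; split_ifs at hab <;> omega
          rw [hb, this, h]
        · have : a = b := by
            simp only [Fin.ext_iff] at *; split_ifs at hab <;> omega
          rw [this]
      rcases x with x | x <;> rcases y with y | y <;> exact aux x y hxy
  rw [pHalf, act_basis]
  simp only [labellingMatrix, key]
  split_ifs with h <;> simp [h]

theorem act_p {m : ℕ} (hm : m < k) (φ : (Fin k → α) → ℤ) (f : Fin k → α) :
    act (p _ X k (m + 1)) φ f = ∑ b, φ (Function.update f ⟨m, hm⟩ b) := by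
  classical
  have key : ∀ g : Fin k → α, PartitionDiagram.p k (m + 1) ≤ Setoid.ker (Sum.elim f g) ↔
      g = Function.update f ⟨m, hm⟩ (g ⟨m, hm⟩) := by
    intro g
    constructor
    · intro h
      funext a
      by_cases ha : a = ⟨m, hm⟩
      · rw [ha, Function.update_self]
      · rw [Function.update_of_ne ha]
        refine (h (show PartitionDiagram.p k (m + 1) (Sum.inl a) (Sum.inr a) from ?_)).symm
        have : a.val ≠ m := fun h => ha (Fin.ext h)
        simp [Setoid.ker_def, idx, this]
    · intro h x y hxy
      have aux : ∀ a : Fin k, a.val ≠ m → g a = f a := by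
        intro a ha
        rw [h, Function.update_of_ne (fun h => ha (congrArg Fin.val h))]
      rcases x with x | x <;> rcases y with y | y <;>
        simp only [Setoid.ker_def, idx, Sum.elim_inl, Sum.elim_inr, Prod.mk.injEq,
          Nat.add_right_cancel_iff, Fin.val_inj, Sum.isRight_inl, Sum.isRight_inr,
          Bool.and_false, Bool.and_true] at hxy <;>
        obtain ⟨rfl, hxy⟩ := hxy <;> simp only [Setoid.ker_def, Sum.elim_inl, Sum.elim_inr]
      · exact (aux _ (by simpa using hxy)).symm
      · exact aux _ (by simpa using hxy)
  rw [p, act_basis]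
  simp only [labellingMatrix, key, ite_mul, one_mul, zero_mul]
  rw [← Finset.sum_filter]
  refine Finset.sum_nbij' (fun g => g ⟨m, hm⟩) (fun b => Function.update f ⟨m, hm⟩ b) ?_ ?_ ?_ ?_ ?_
  · simp
  · simp
  · intro g hg
    exact (Finset.mem_filter.1 hg).2.symm
  · simp
  · intro g hg
    exact congrArg φ (Finset.mem_filter.1 hg).2

end PartitionAlgebra

/-! ### Words with three marked letters. -/

namespace PartitionAlgebra

open Polynomial PartitionDiagram

variable {k : ℕ} {α : Type*}

/-- Apply `τ` to the first `m` letters of a word. -/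
def relabel (m : ℕ) (τ : α → α) (f : Fin k → α) : Fin k → α :=
  fun j => if j.val < m then τ (f j) else f j

/-- The word obtained from `f` by applying `τ` to the first `m` letters and replacing the next
three letters by `a`, `b` and `c`. -/
def respell (m : ℕ) (τ : α → α) (f : Fin k → α) (a b c : α) : Fin k → α :=
  fun j => if j.val < m then τ (f j) else if j.val = m then a else if j.val = m + 1 then b
    else if j.val = m + 2 then c else f j

section Words

variable {m : ℕ} (σ τ : α → α) (f : Fin k → α) (a b c d : α)

/-- Here `τ = id` suffices; a general `τ` makes the family of such words stable under relabelling.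
Marked positions beyond the end of the word receive irrelevant letters. -/
theorem exists_eq_respell [Nonempty α] (m : ℕ) (f : Fin k → α) :
    ∃ (τ : α → α) (g : Fin k → α) (a b c : α), f = respell m τ g a b c := by
  classical
  let g : ℕ → α := fun j => if h : j < k then f ⟨j, h⟩ else Classical.arbitrary α
  have hg : ∀ j : Fin k, f j = g j := fun j => by simp [g]
  refine ⟨id, f, g m, g (m + 1), g (m + 2), funext fun j => ?_⟩
  simp only [respell, hg, id]
  split_ifs <;> simp_all

theorem respell_first (h : m < k) : respell m τ f a b c ⟨m, h⟩ = a := by simp [respell]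

theorem respell_second (h : m + 1 < k) : respell m τ f a b c ⟨m + 1, h⟩ = b := by simp [respell]

theorem respell_third (h : m + 2 < k) : respell m τ f a b c ⟨m + 2, h⟩ = c := by simp [respell]

theorem relabel_respell_zero :
    relabel m σ (respell m τ f a b c) = respell m (σ ∘ τ) f a b c := by
  funext j; simp only [relabel, respell, Function.comp_apply]; grind

theorem relabel_respell_one :
    relabel (m + 1) σ (respell m τ f a b c) = respell m (σ ∘ τ) f (σ a) b c := by
  funext j; simp only [relabel, respell, Function.comp_apply]; grind

theorem relabel_respell_two :
    relabel (m + 2) σ (respell m τ f a b c) = respell m (σ ∘ τ) f (σ a) (σ b) c := by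
  funext j; simp only [relabel, respell, Function.comp_apply]; grind

theorem relabel_respell_three :
    relabel (m + 3) σ (respell m τ f a b c) = respell m (σ ∘ τ) f (σ a) (σ b) (σ c) := by
  funext j; simp only [relabel, respell, Function.comp_apply]; grind

theorem respell_comp_swap_first (h0 : m < k) (h1 : m + 1 < k) :
    respell m τ f a b c ∘ Equiv.swap ⟨m, h0⟩ ⟨m + 1, h1⟩ = respell m τ f b a c := by
  funext j; simp only [respell, Function.comp_apply, Equiv.swap_apply_def, Fin.ext_iff]; grind

theorem respell_comp_swap_second (h1 : m + 1 < k) (h2 : m + 2 < k) :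
    respell m τ f a b c ∘ Equiv.swap ⟨m + 1, h1⟩ ⟨m + 2, h2⟩ = respell m τ f a c b := by
  funext j; simp only [respell, Function.comp_apply, Equiv.swap_apply_def, Fin.ext_iff]; grind

theorem update_respell_second (h : m + 1 < k) :
    Function.update (respell m τ f a b c) ⟨m + 1, h⟩ d = respell m τ f a d c := by
  funext j; simp only [respell, Function.update_apply, Fin.ext_iff]; grind

end Words

variable [Fintype α] [DecidableEq α]

/-- The action of `L_{m+1}`: the sum over all letters `b` of the transposition of `b` with the
letter `m + 1`, applied to the first `m + 1` letters. -/
def ActsAsL (α : Type*) [Fintype α] [DecidableEq α] (m : ℕ) (x : PartitionAlgebra ℤ[X] X k) :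
    Prop :=
  ∀ (h : m < k) (φ : (Fin k → α) → ℤ) (f : Fin k → α),
    act x φ f = ∑ b, φ (relabel (m + 1) (Equiv.swap (f ⟨m, h⟩) b) f)

/-- The action by the transposition of the letters `m + 1` and `m + 2`, applied to the first `r`
letters.  This is the action of `σ_{m+2}` if `r = m + 2` and of `σ_{m+3/2}` if `r = m`. -/
def ActsAsSwap (α : Type*) [Fintype α] [DecidableEq α] (r m : ℕ)
    (x : PartitionAlgebra ℤ[X] X k) : Prop :=
  ∀ (h : m + 1 < k) (φ : (Fin k → α) → ℤ) (f : Fin k → α), act x φ f =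
    φ (relabel r (Equiv.swap (f ⟨m, Nat.lt_of_succ_lt h⟩) (f ⟨m + 1, h⟩)) f)

section Respell

variable {m : ℕ} (φ : (Fin k → α) → ℤ) (τ : α → α) (f : Fin k → α) (a b c : α)

theorem act_s_first (h : m + 1 < k) :
    act (s _ X k (m + 1)) φ (respell m τ f a b c) = φ (respell m τ f b a c) := by
  rw [act_s h, respell_comp_swap_first]

theorem act_s_second (h : m + 2 < k) :
    act (s _ X k (m + 2)) φ (respell m τ f a b c) = φ (respell m τ f a c b) := by
  rw [act_s h, respell_comp_swap_second]

theorem act_pHalf_first (h : m + 1 < k) :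
    act (pHalf _ X k (m + 1)) φ (respell m τ f a b c) =
      if a = b then φ (respell m τ f a b c) else 0 := by
  rw [act_pHalf h, respell_first, respell_second]

theorem act_pHalf_second (h : m + 2 < k) :
    act (pHalf _ X k (m + 2)) φ (respell m τ f a b c) =
      if b = c then φ (respell m τ f a b c) else 0 := by
  rw [act_pHalf h, respell_second, respell_third]

theorem act_p_second (h : m + 1 < k) :
    act (p _ X k (m + 2)) φ (respell m τ f a b c) = ∑ d, φ (respell m τ f a d c) := by
  simp only [act_p h, update_respell_second]

theorem ActsAsL.act_respell {x : PartitionAlgebra ℤ[X] X k} (hx : ActsAsL α m x) (h : m < k) :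
    act x φ (respell m τ f a b c) =
      ∑ d, φ (respell m (Equiv.swap a d ∘ τ) f d b c) := by
  simp only [hx h, respell_first, relabel_respell_one, Equiv.swap_apply_left]

theorem ActsAsSwap.act_respell_all {x : PartitionAlgebra ℤ[X] X k} (hx : ActsAsSwap α (m + 2) m x)
    (h : m + 1 < k) :
    act x φ (respell m τ f a b c) =
      φ (respell m (Equiv.swap a b ∘ τ) f b a c) := by
  simp only [hx h, respell_first, respell_second, relabel_respell_two, Equiv.swap_apply_left,
    Equiv.swap_apply_right]

theorem ActsAsSwap.act_respell_initial {x : PartitionAlgebra ℤ[X] X k} (hx : ActsAsSwap α m m x)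
    (h : m + 1 < k) :
    act x φ (respell m τ f a b c) =
      φ (respell m (Equiv.swap a b ∘ τ) f a b c) := by
  simp only [hx h, respell_first, respell_second, relabel_respell_zero]

end Respell

/-! ### The recursions preserve the closed forms. -/

theorem ActsAsL.sigmaStep {m : ℕ} {M S : PartitionAlgebra ℤ[X] X k} (hM : ActsAsL α m M)
    (hS : ActsAsSwap α (m + 2) m S) :
    ActsAsSwap α (m + 3) (m + 1) (sigmaStep ℤ[X] X k (m + 2) S M) := by
  intro h2 φ f
  have h1 : m + 1 < k := by omega
  have h0 : m < k := by omega
  have : Nonempty α := ⟨f ⟨m, h0⟩⟩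
  obtain ⟨τ, g, a, b, c, rfl⟩ := exists_eq_respell m f
  simp only [PartitionAlgebra.sigmaStep, Nat.add_succ_sub_one, act_add, act_sub, act_mul,
    act_s_first _ _ _ _ _ _ h1, act_s_second _ _ _ _ _ _ h2, act_pHalf_first _ _ _ _ _ _ h1,
    act_pHalf_second _ _ _ _ _ _ h2, act_p_second _ _ _ _ _ _ h1, hM.act_respell _ _ _ _ _ _ h0,
    hS.act_respell_all _ _ _ _ _ _ h1, Finset.sum_ite_eq, Finset.sum_ite_eq', Finset.mem_univ,
    if_true, respell_second, respell_third, relabel_respell_three, Equiv.swap_apply_left,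
    Equiv.swap_apply_right]
  -- The conjugate of `S` gives marked letters `a, c, b`, which is right unless `a` is moved by the
  -- transposition of `b` and `c`. The second and third terms give the right value when `a = c` and
  -- `a = b` respectively; the two negative terms cancel the first term in these cases.
  by_cases hab : a = b
  · subst hab
    by_cases hac : a = c
    · subst hac; simp
    · simp [hac, Equiv.swap_comm c a]
  · by_cases hac : a = c
    · subst hac; simp [hab, Equiv.swap_comm b a]
    · simp [hab, hac, Equiv.swap_apply_of_ne_of_ne]

theorem ActsAsL.sigmaHalfStep {m : ℕ} {M S : PartitionAlgebra ℤ[X] X k} (hM : ActsAsL α m M)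
    (hS : ActsAsSwap α m m S) :
    ActsAsSwap α (m + 1) (m + 1) (sigmaHalfStep ℤ[X] X k (m + 2) S M) := by
  intro h2 φ f
  have h1 : m + 1 < k := by omega
  have h0 : m < k := by omega
  have : Nonempty α := ⟨f ⟨m, h0⟩⟩
  obtain ⟨τ, g, a, b, c, rfl⟩ := exists_eq_respell m f
  simp only [PartitionAlgebra.sigmaHalfStep, Nat.add_succ_sub_one, act_add, act_sub, act_mul,
    act_s_first _ _ _ _ _ _ h1, act_s_second _ _ _ _ _ _ h2, act_pHalf_first _ _ _ _ _ _ h1,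
    act_pHalf_second _ _ _ _ _ _ h2, act_p_second _ _ _ _ _ _ h1, hM.act_respell _ _ _ _ _ _ h0,
    hS.act_respell_initial _ _ _ _ _ _ h1, Finset.sum_ite_eq, Finset.sum_ite_eq', Finset.mem_univ,
    if_true, respell_second, respell_third, relabel_respell_one]
  -- The same cancellation, with the second and third terms now serving `a = b` and `a = c`.
  by_cases hab : a = b
  · subst hab
    by_cases hac : a = c
    · subst hac; simp
    · simp [hac]
  · by_cases hac : a = c
    · subst hac; simp [hab, Equiv.swap_comm b a]
    · simp [hab, hac, Equiv.swap_apply_of_ne_of_ne]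

theorem ActsAsL.LStep {m : ℕ} {M S : PartitionAlgebra ℤ[X] X k} (hM : ActsAsL α m M)
    (hS : ActsAsSwap α (m + 2) m S) : ActsAsL α (m + 1) (LStep ℤ[X] X k (m + 1) M S) := by
  intro h1 φ f
  have h0 : m < k := by omega
  have : Nonempty α := ⟨f ⟨m, h0⟩⟩
  obtain ⟨τ, g, a, b, c, rfl⟩ := exists_eq_respell m f
  simp only [PartitionAlgebra.LStep, act_add, act_sub, act_neg, act_mul,
    act_s_first _ _ _ _ _ _ h1, act_pHalf_first _ _ _ _ _ _ h1, act_p_second _ _ _ _ _ _ h1,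
    hM.act_respell _ _ _ _ _ _ h0, hS.act_respell_all _ _ _ _ _ _ h1, Finset.sum_ite_eq,
    Finset.sum_ite_eq', Finset.mem_univ, if_true, respell_second, relabel_respell_two,
    Equiv.swap_apply_left]
  -- If `a = b`, the term with `p` is the required sum and the other four cancel in pairs.
  by_cases hab : a = b
  · subst hab
    simp
    ring
  -- For `a ≠ b`, the conjugate of `M` is wrong only in the summand `d = a`: `S` supplies the right
  -- value and the first negative term removes the wrong one.
  · have key : ∀ d, φ (respell m (Equiv.swap b d ∘ τ) g (Equiv.swap b d a) d c) =
        φ (respell m (Equiv.swap b d ∘ τ) g a d c) +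
          if d = a then φ (respell m (Equiv.swap b a ∘ τ) g b a c) -
            φ (respell m (Equiv.swap b a ∘ τ) g a a c) else 0 := by
      intro d
      by_cases hd : d = a
      · subst hd; simp
      · simp [hd, Equiv.swap_apply_of_ne_of_ne hab (Ne.symm hd)]
    simp only [key, Finset.sum_add_distrib, Finset.sum_ite_eq', Finset.mem_univ, if_true]
    simp [hab, Equiv.swap_comm b a]
    ring

/-! ### Initial values, induction, and the involution property. -/

theorem actsAsL_one : ActsAsL α 0 (L ℤ[X] X k 1) := by
  intro h φ f
  rw [L_one, act_p h]
  refine Finset.sum_congr rfl fun b _ => congrArg φ (funext fun j => ?_)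
  by_cases hj : j = ⟨0, h⟩
  · subst hj; simp [relabel]
  · have : j.val ≠ 0 := fun h => hj (Fin.ext h)
    simp [relabel, hj, this]

theorem actsAsSwap_sigma_two : ActsAsSwap α 2 0 (sigma ℤ[X] X k 2) := by
  intro h φ f
  rw [sigma_two, act_s h]
  refine congrArg φ (funext fun j => ?_)
  simp only [relabel, Function.comp_apply, Equiv.swap_apply_def, Fin.ext_iff]
  grind

theorem actsAsSwap_sigmaHalf_one : ActsAsSwap α 0 0 (sigmaHalf ℤ[X] X k 1) := by
  intro h φ f
  rw [sigmaHalf_one, act_one]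
  exact congrArg φ (funext fun j => by simp [relabel])

/-- The induction is simultaneous because both recursion steps use both descriptions. -/
theorem actsAs_L_sigma (m : ℕ) :
    ActsAsL α m (L ℤ[X] X k (m + 1)) ∧ ActsAsSwap α (m + 2) m (sigma ℤ[X] X k (m + 2)) := by
  induction m with
  | zero => exact ⟨actsAsL_one, actsAsSwap_sigma_two⟩
  | succ m ih =>
    rw [L_succ _ _ _ (m + 1) (by omega), sigma_succ _ _ _ (m + 2) (by omega)]
    exact ⟨ih.1.LStep ih.2, ih.1.sigmaStep ih.2⟩

theorem actsAsSwap_sigmaHalf (m : ℕ) : ActsAsSwap α m m (sigmaHalf ℤ[X] X k (m + 1)) := by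
  induction m with
  | zero => exact actsAsSwap_sigmaHalf_one
  | succ m ih =>
    rw [sigmaHalf_eq _ _ _ (m + 2) (by omega)]
    exact (actsAs_L_sigma m).1.sigmaHalfStep ih

/-- The restriction on `r` matters: `r = m` fixes the two determining letters and `r = m + 2`
exchanges them, whereas `r = m + 1` would change one alone. -/
theorem ActsAsSwap.act_act {r m : ℕ} {x : PartitionAlgebra ℤ[X] X k} (hx : ActsAsSwap α r m x)
    (hr : r = m ∨ r = m + 2) (h : m + 1 < k) (φ : (Fin k → α) → ℤ) : act x (act x φ) = φ := by
  funext f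
  have : Nonempty α := ⟨f ⟨m + 1, h⟩⟩
  obtain ⟨τ, g, a, b, c, rfl⟩ := exists_eq_respell m f
  rcases hr with rfl | rfl
  · rw [hx.act_respell_initial _ _ _ _ _ _ h, hx.act_respell_initial _ _ _ _ _ _ h]
    simp [← Function.comp_assoc, ← Equiv.coe_trans]
  · rw [hx.act_respell_all _ _ _ _ _ _ h, hx.act_respell_all _ _ _ _ _ _ h, Equiv.swap_comm b a]
    simp [← Function.comp_assoc, ← Equiv.coe_trans]

theorem sq_eq_one_of_actsAsSwap {r m : ℕ} {x : PartitionAlgebra ℤ[X] X k}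
    (hx : ∀ n, ActsAsSwap (Fin n) r m x) (hr : r = m ∨ r = m + 2) (h : m + 1 < k) : x ^ 2 = 1 := by
  refine eq_one_of_act_eq _ fun n φ => ?_
  rw [pow_two, act_mul, (hx n).act_act hr h]

end PartitionAlgebra

/-- For all `i ≥ 0`, the elements `σ_{i+1/2}` and `σ_{i+1}` of the partition algebra over `ℤ[z]`
are involutions; they are considered in every `𝒜_k(z)` with `k ≥ i + 1`. -/
theorem mainTheorem5 (k i : ℕ) (hik : i + 1 ≤ k) :
    PartitionAlgebra.sigmaHalf (Polynomial ℤ) Polynomial.X k i ^ 2 = 1 ∧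
      PartitionAlgebra.sigma (Polynomial ℤ) Polynomial.X k (i + 1) ^ 2 = 1 := by
  cases i with
  -- The closed forms start at $\sigma_{3/2}$ and $\sigma_2$; for `i = 0` both elements are `1` by
  -- definition.
  | zero => simp [PartitionAlgebra.sigmaHalf_zero, PartitionAlgebra.sigma_one]
  | succ m =>
    exact ⟨PartitionAlgebra.sq_eq_one_of_actsAsSwap
        (fun _ => PartitionAlgebra.actsAsSwap_sigmaHalf m) (Or.inl rfl) hik,
      PartitionAlgebra.sq_eq_one_of_actsAsSwap
        (fun _ => (PartitionAlgebra.actsAs_L_sigma m).2) (Or.inr rfl) hik⟩
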